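/- Let $n\ge 0$ and let $F = x_0^{d_0}\cdots x_n^{d_n}\in\mathbb{C}[x_0,\dots,x_n]$ with integers $0<d_0\le d_1\le\dots\le d_n$, and put $d=d_0+\dots+d_n$. Let $r=R(F)$ be the Waring rank of $F$, that is, the least number $r$ such that $F=\ell_1^d+\dots+\ell_r^d$ for some linear forms $\ell_1,\dots,\ell_r$. Let $\mathrm{VSP}^\circ(F)$ be the set of all sets $Q=\{[\ell_1],\dots,[\ell_r]\}$ of $r$ distinct points in the projective space of linear forms in $x_0,\dots,x_n$ such that $F=\ell_1^d+\dots+\ell_r^d$ for suitable representatives $\ell_j$. The group $(\mathbb{C}^*)^{n+1}$ acts on $\mathbb{C}[x_0,\dots,x_n]$ by scaling the variables, $x_i\mapsto\lambda_i x_i$. The subgroup $\mathcal{T}=\{(\lambda_0,\dots,\lambda_n)\in(\mathbb{C}^*)^{n+1} : \prod_i\lambda_i^{d_i}=1\}$ leaves $F$ fixed, and so it acts on $\mathrm{VSP}^\circ(F)$. Then $\mathrm{VSP}^\circ(F)$ is non-empty, and the action of $\mathcal{T}$ on $\mathrm{VSP}^\circ(F)$ is transitive if and only if $d_0=\dots=d_n$.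 Moreover, suppose $d_0=\dots=d_n=k$. For each $Q\in\mathrm{VSP}^\circ(F)$ let $\mathcal{I}(Q)\subset\mathbb{C}[\alpha_0,\dots,\alpha_n]$ be the ideal generated by the homogeneous polynomials vanishing on $Q$, where the $\alpha_i$ are the homogeneous coordinates given by the coefficients of $x_i$ in a linear form. Then there are nonzero constants $c_1,\dots,c_n\in\mathbb{C}$ with $$\mathcal{I}(Q)=\bigl(\alpha_i^{k+1}-c_i\,\alpha_0^{k+1} : i=1,\dots,n\bigr),$$ and there is $t\in\mathcal{T}$ with $$\mathcal{I}(t\cdot Q)=\bigl(\alpha_i^{k+1}-\alpha_0^{k+1} : i=1,\dots,n\bigr).$$ -/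

import Mathlib

open scoped LinearAlgebra.Projectivization Pointwise

noncomputable section

namespace Waring

/-- The polynomial ring in `n + 1` variables over the complex numbers. -/
abbrev Poly (n : ℕ) : Type := MvPolynomial (Fin (n + 1)) ℂ

/-- The space of linear forms `a₀ x₀ + ⋯ + aₙ xₙ`. -/
abbrev LinForm (n : ℕ) : Type := MvPolynomial.homogeneousSubmodule (Fin (n + 1)) ℂ 1

/-- The big torus `(ℂ*)ⁿ⁺¹`. -/
abbrev BigTorus (n : ℕ) : Type := Fin (n + 1) → ℂˣ

/-- The substitution `xᵢ ↦ tᵢ xᵢ`. -/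
def scale {n : ℕ} (t : BigTorus n) : Poly n →ₐ[ℂ] Poly n :=
  MvPolynomial.aeval fun i => MvPolynomial.C (t i : ℂ) * MvPolynomial.X i

theorem scale_X {n : ℕ} (t : BigTorus n) (i : Fin (n + 1)) :
    scale t (MvPolynomial.X i) = MvPolynomial.C (t i : ℂ) * MvPolynomial.X i := by
  simp [scale]

theorem scale_one {n : ℕ} : scale (1 : BigTorus n) = AlgHom.id ℂ (Poly n) := by
  apply MvPolynomial.algHom_ext
  intro i
  simp [scale]

theorem scale_mul {n : ℕ} (s t : BigTorus n) : scale (s * t) = (scale s).comp (scale t) := by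
  apply MvPolynomial.algHom_ext
  intro i
  simp only [scale_X, AlgHom.comp_apply, map_mul, MvPolynomial.algHom_C,
    MvPolynomial.algebraMap_eq, Pi.mul_apply, Units.val_mul]
  ring

/-- The big torus acts on the polynomial ring by scaling the variables. -/
instance scaleAction (n : ℕ) : MulSemiringAction (BigTorus n) (Poly n) where
  smul t f := scale t f
  one_smul f := by change scale 1 f = f; rw [scale_one]; rfl
  mul_smul s t f := by change scale (s * t) f = scale s (scale t f); rw [scale_mul]; rfl
  smul_zero t := map_zero (scale t)
  smul_add t := map_add (scale t)
  smul_one t := map_one (scale t)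
  smul_mul t := map_mul (scale t)

theorem smul_poly_def {n : ℕ} (t : BigTorus n) (f : Poly n) : t • f = scale t f := rfl

theorem smul_mem_linForm {n : ℕ} (t : BigTorus n) (l : LinForm n) :
    t • (l : Poly n) ∈ MvPolynomial.homogeneousSubmodule (Fin (n + 1)) ℂ 1 := by
  have h := (MvPolynomial.mem_homogeneousSubmodule 1 (l : Poly n)).1 l.2
  have h2 := h.aeval (fun i => MvPolynomial.C (t i : ℂ) * (MvPolynomial.X i : Poly n))
    (n := 1) (fun i => by
      simpa using (MvPolynomial.isHomogeneous_C (Fin (n + 1)) (t i : ℂ)).mul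
        (MvPolynomial.isHomogeneous_X ℂ i))
  rw [MvPolynomial.mem_homogeneousSubmodule]
  rw [smul_poly_def, scale]
  simpa only [one_mul] using h2

/-- The induced action on linear forms. -/
instance linFormAction (n : ℕ) : DistribMulAction (BigTorus n) (LinForm n) where
  smul t l := ⟨t • (l : Poly n), smul_mem_linForm t l⟩
  one_smul l := Subtype.ext (one_smul _ (l : Poly n))
  mul_smul s t l := Subtype.ext (mul_smul s t (l : Poly n))
  smul_zero t := Subtype.ext (smul_zero (A := Poly n) t)
  smul_add t l m := Subtype.ext (smul_add t (l : Poly n) (m : Poly n))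

theorem coe_smul_linForm {n : ℕ} (t : BigTorus n) (l : LinForm n) :
    ((t • l : LinForm n) : Poly n) = t • (l : Poly n) := rfl

/-- Scaling the variables is linear, hence induces an action on the projective space of linear
forms. -/
instance linFormSMulComm (n : ℕ) : SMulCommClass (BigTorus n) ℂ (LinForm n) where
  smul_comm t c l := Subtype.ext (map_smul (scale t) c (l : Poly n))

/-- The projective space `ℙ(T₁)` of linear forms up to scalars. -/
abbrev PLin (n : ℕ) : Type := ℙ ℂ (LinForm n)

/-- The Waring rank of a form `F` of degree `e`: the least number `r` of linear forms such that
`F` is the sum of their `e`-th powers. -/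
def waringRank {n : ℕ} (e : ℕ) (F : Poly n) : ℕ :=
  sInf {r : ℕ | ∃ l : Fin r → LinForm n, F = ∑ j, (l j : Poly n) ^ e}

/-- `VSP°(F, r)` for a form `F` of degree `e`: the sets `{[l₁], …, [l_r]}` of `r` distinct points
of `ℙ(T₁)` (that is, the reduced members of the Hilbert scheme of length `r` subschemes) such that
`F = l₁ᵉ + ⋯ + l_rᵉ`. -/
def VSPo {n : ℕ} (e r : ℕ) (F : Poly n) : Set (Set (PLin n)) :=
  {Q | ∃ (l : Fin r → LinForm n) (hl : ∀ j, l j ≠ 0),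
    Function.Injective (fun j => Projectivization.mk ℂ (l j) (hl j)) ∧
    Q = Set.range (fun j => Projectivization.mk ℂ (l j) (hl j)) ∧
    F = ∑ j, (l j : Poly n) ^ e}

/-- The monomial `x₀^{d₀} ⋯ xₙ^{dₙ}`. -/
def monomialForm {n : ℕ} (d : Fin (n + 1) → ℕ) : Poly n := ∏ i, MvPolynomial.X i ^ d i

/-- The subgroup `{(λᵢ) : ∏ λᵢ^{dᵢ} = 1}` of the big torus. -/
def torus {n : ℕ} (d : Fin (n + 1) → ℕ) : Subgroup (BigTorus n) where
  carrier := {t | ∏ i, t i ^ d i = 1}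
  one_mem' := by simp
  mul_mem' := by
    intro s t hs ht
    simp only [Set.mem_ofPred_eq] at hs ht ⊢
    simp [mul_pow, Finset.prod_mul_distrib, hs, ht]
  inv_mem' := by
    intro t ht
    simp only [Set.mem_ofPred_eq] at ht ⊢
    simp [inv_pow, Finset.prod_inv_distrib, ht]

theorem smul_monomialForm {n : ℕ} (d : Fin (n + 1) → ℕ) {t : BigTorus n} (ht : t ∈ torus d) :
    t • monomialForm d = monomialForm d := by
  have h : ∏ i, t i ^ d i = 1 := ht
  have h' : ∏ i, (t i : ℂ) ^ d i = 1 := by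
    have := congrArg (fun u : ℂˣ => (u : ℂ)) h
    simpa using this
  have h2 : ∏ i, (MvPolynomial.C (t i : ℂ) : Poly n) ^ d i = 1 := by
    simp only [← map_pow, ← map_prod, h', map_one]
  rw [smul_poly_def, monomialForm, map_prod]
  simp only [map_pow, scale_X, mul_pow, Finset.prod_mul_distrib, h2, one_mul]

theorem smul_mem_VSPo {n : ℕ} (e r : ℕ) {F : Poly n} {t : BigTorus n} (ht : t • F = F)
    {Q : Set (PLin n)} (hQ : Q ∈ VSPo e r F) : t • Q ∈ VSPo e r F := by
  obtain ⟨l, hl, hinj, rfl, hF⟩ := hQ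
  refine ⟨fun j => t • l j, fun j => (smul_ne_zero_iff_ne t).2 (hl j), ?_, ?_, ?_⟩
  · intro i j hij
    apply hinj
    exact smul_left_cancel t hij
  · rw [← Set.image_smul, ← Set.range_comp]
    rfl
  · conv_lhs => rw [← ht, hF]
    simp only [Finset.smul_sum, smul_pow', coe_smul_linForm]

/-- `VSP°(F)` for the monomial `F = x₀^{d₀} ⋯ xₙ^{dₙ}`, of degree `d₀ + ⋯ + dₙ` and with `r` the
Waring rank of `F`, together with the action on it of the subgroup `torus d` that fixes `F`. -/
def VSPmono {n : ℕ} (d : Fin (n + 1) → ℕ) : SubMulAction (torus d) (Set (PLin n)) where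
  carrier := VSPo (∑ i, d i) (waringRank (∑ i, d i) (monomialForm d)) (monomialForm d)
  smul_mem' t _ hQ := smul_mem_VSPo _ _ (smul_monomialForm d t.2) hQ

/-- The coordinates of a linear form: its coefficients at `x₀, …, xₙ`. -/
def coords {n : ℕ} (l : LinForm n) : Fin (n + 1) → ℂ :=
  fun i => MvPolynomial.coeff (Finsupp.single i 1) (l : Poly n)

/-- The homogeneous ideal in `ℂ[α₀, …, αₙ]` of a set `Q` of points of `ℙ(T₁)`: it is generated by
the homogeneous polynomials in the coordinates that vanish on `Q`. -/
def vanishingIdeal {n : ℕ} (Q : Set (PLin n)) : Ideal (MvPolynomial (Fin (n + 1)) ℂ) :=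
  Ideal.span {g | (∃ m : ℕ, g.IsHomogeneous m) ∧
    ∀ (l : LinForm n) (hl : l ≠ 0), Projectivization.mk ℂ l hl ∈ Q →
      MvPolynomial.eval (coords l) g = 0}

/-- The ideal `(α_i^{k+1} - c_i α_0^{k+1} : i = 1, …, n)`; here `c i` stands for `c_{i+1}`. -/
def powerIdeal {n : ℕ} (k : ℕ) (c : Fin n → ℂ) : Ideal (MvPolynomial (Fin (n + 1)) ℂ) :=
  Ideal.span (Set.range fun i : Fin n =>
    MvPolynomial.X i.succ ^ (k + 1) - MvPolynomial.C (c i) * MvPolynomial.X 0 ^ (k + 1))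

end Waring

end

noncomputable section

namespace Waring

open MvPolynomial

/-! ### Coordinates of linear forms -/

/-! By the multinomial theorem, a power sum decomposition of the monomial amounts to moment
conditions on its coefficient vectors: among exponents of degree `∑ i, d i`, only `d` has a nonzero
moment (`monomialForm_eq_sum_iff`). Pass to affine nodes by dividing by the coordinate at `x₀`. A
polynomial of degree at most `∑ i, d i` that vanishes at the nodes then has no `z^(tail d)` term,
provided that its degree is smaller if there are points at infinity (`HasMoments.coeff_eq_zero`).

Multiplying by a monomial that moves a top-degree term to `z^(tail d)` shows that no nonzero
polynomial with exponents in the box below `tail d` vanishes at all nodes. Counting dimensions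
bounds the rank below by `∏ (d i.succ + 1)`. Products of one-variable quadrature rules on roots of
unity attain this bound. If some `d i > d 0`, another rule for that variable has `0` as a node;
since the torus preserves the vanishing of a coordinate, the two decompositions lie in different
orbits.

If all exponents equal `k`, the nodes of a minimal decomposition interpolate uniquely in the box.
The same top-term argument forces the interpolant of `zᵢ^(k+1)` to be a constant `cᵢ ≠ 0`
(`HasMoments.exists_pow_eq`), so by counting the nodes are all solutions of `zᵢ^(k+1) = cᵢ`.
Rescaling gives transitivity, and reduction to the box gives the ideal. -/

theorem coe_eq_sum_coords {n : ℕ} (l : LinForm n) :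
    (l : Poly n) = ∑ i, coords l i • X i := by
  classical
  have hl := (mem_homogeneousSubmodule 1 (l : Poly n)).1 l.2
  ext m
  rw [coeff_sum]
  simp only [coeff_smul, coeff_X, smul_eq_mul, mul_ite, mul_one, mul_zero]
  by_cases hm : m.degree = 1
  · obtain ⟨i, rfl⟩ : m ∈ Set.range fun i : Fin (n + 1) => Finsupp.single i 1 := by
      rw [Finsupp.range_single_one]
      exact hm
    rw [Finset.sum_eq_single i]
    · simp [coords]
    · intro j _ hj
      rw [if_neg]
      intro h
      exact hj ((Finsupp.single_left_inj one_ne_zero).1 h)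
    · simp
  · rw [hl.coeff_eq_zero hm, Finset.sum_eq_zero]
    intro i _
    rw [if_neg]
    rintro rfl
    simp at hm

/-- The linear form with prescribed coordinates. -/
def ofCoords {n : ℕ} (a : Fin (n + 1) → ℂ) : LinForm n :=
  ⟨∑ i, a i • X i, Submodule.sum_mem _ fun i _ =>
    Submodule.smul_mem _ _ ((mem_homogeneousSubmodule 1 _).2 (isHomogeneous_X ℂ i))⟩

theorem coords_ofCoords {n : ℕ} (a : Fin (n + 1) → ℂ) : coords (ofCoords a) = a := by
  classical
  funext i
  simp [coords, ofCoords, coeff_sum, coeff_X, Finsupp.single_left_inj]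

theorem coords_injective {n : ℕ} : Function.Injective (coords (n := n)) := by
  intro l m h
  apply Subtype.ext
  rw [coe_eq_sum_coords, coe_eq_sum_coords m, h]

theorem coords_smul {n : ℕ} (c : ℂ) (l : LinForm n) : coords (c • l) = c • coords l := by
  funext i
  simp [coords]

theorem coords_zero {n : ℕ} : coords (0 : LinForm n) = 0 := by
  funext i
  simp [coords]

theorem coords_torus_smul {n : ℕ} (t : BigTorus n) (l : LinForm n) (i : Fin (n + 1)) :
    coords (t • l) i = t i * coords l i := by
  have : t • l = ofCoords (fun i => t i * coords l i) := by
    apply Subtype.ext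
    rw [coe_smul_linForm, smul_poly_def, coe_eq_sum_coords l, map_sum]
    simp [ofCoords, scale_X, smul_eq_C_mul, mul_comm, mul_left_comm]
  rw [this, coords_ofCoords]

/-! ### Power sum decompositions and moments -/

/-- Summation over the points `a j` of monomials of the degree of `d` picks out, up to the factor
`κ`, the monomial with exponent `d`. -/
def HasMoments {n : ℕ} {ι : Type*} [Fintype ι] (d : Fin (n + 1) → ℕ) (κ : ℂ)
    (a : ι → Fin (n + 1) → ℂ) : Prop :=
  ∀ m : Fin (n + 1) → ℕ, ∑ i, m i = ∑ i, d i →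
    ∑ j, ∏ i, a j i ^ m i = if m = d then κ else 0

/-- The multinomial coefficient of the monomial with exponent `d`. -/
def multinomialCoeff {n : ℕ} (d : Fin (n + 1) → ℕ) : ℂ :=
  ((Finsupp.equivFunOnFinite.symm d).multinomial : ℂ)

theorem multinomialCoeff_ne_zero {n : ℕ} (d : Fin (n + 1) → ℕ) : multinomialCoeff d ≠ 0 := by
  rw [multinomialCoeff, Nat.cast_ne_zero, Finsupp.multinomial_eq]
  exact (Nat.multinomial_pos _ _).ne'

theorem coeff_linForm_pow {n : ℕ} (l : LinForm n) (m : Fin (n + 1) → ℕ) (e : ℕ) :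
    coeff (Finsupp.equivFunOnFinite.symm m) ((l : Poly n) ^ e) =
      if ∑ i, m i = e then multinomialCoeff m * ∏ i, coords l i ^ m i else 0 := by
  rw [coe_eq_sum_coords l, coeff_linearCombination_X_pow_of_fintype,
    Finsupp.sum_fintype _ _ (by simp), Finsupp.prod_fintype _ _ (by simp)]
  rfl

theorem coeff_monomialForm {n : ℕ} (d m : Fin (n + 1) → ℕ) :
    coeff (Finsupp.equivFunOnFinite.symm m) (monomialForm d) = if m = d then 1 else 0 := by
  classical
  have : monomialForm d = monomial (Finsupp.equivFunOnFinite.symm d) (1 : ℂ) := by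
    rw [monomial_eq, Finsupp.prod_fintype _ _ (by simp)]
    simp [monomialForm]
  rw [this, coeff_monomial]
  simp [eq_comm]

theorem monomialForm_eq_sum_iff {n : ℕ} {ι : Type*} [Fintype ι] (d : Fin (n + 1) → ℕ)
    (l : ι → LinForm n) :
    monomialForm d = ∑ j, (l j : Poly n) ^ (∑ i, d i) ↔
      HasMoments d (multinomialCoeff d)⁻¹ fun j => coords (l j) := by
  constructor
  · intro h m hm
    have h1 := congrArg (coeff (Finsupp.equivFunOnFinite.symm m)) h
    simp only [coeff_monomialForm, coeff_sum, coeff_linForm_pow, hm, if_true,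
      ← Finset.mul_sum] at h1
    have h2 := multinomialCoeff_ne_zero m
    split_ifs at h1 ⊢ with hmd
    · subst hmd
      field_simp
      rw [mul_comm]
      exact h1.symm
    · exact (mul_eq_zero.1 h1.symm).resolve_left h2
  · intro h
    ext m
    obtain ⟨m, rfl⟩ := Finsupp.equivFunOnFinite.symm.surjective m
    simp only [coeff_monomialForm, coeff_sum, coeff_linForm_pow]
    by_cases hm : ∑ i, m i = ∑ i, d i
    · simp only [hm, if_true, ← Finset.mul_sum]
      rw [h m hm]
      split_ifs with hmd
      · subst hmd
        rw [mul_inv_cancel₀ (multinomialCoeff_ne_zero m)]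
      · simp
    · have : m ≠ d := by rintro rfl; exact hm rfl
      simp [hm, this]

/-! ### Polynomials vanishing on the affine points of a decomposition -/

/-- Homogenize `f` to degree `∑ i, d i` and sum its values over the points `a j`: every value is
zero, while the moments leave only `κ` times the required coefficient. At a point at infinity the
homogenization vanishes because strict degree leaves a factor of the zeroth coordinate. -/
theorem HasMoments.coeff_eq_zero {n : ℕ} {ι : Type*} [Fintype ι] {d : Fin (n + 1) → ℕ} {κ : ℂ}
    {a : ι → Fin (n + 1) → ℂ} (ha : HasMoments d κ a) (hκ : κ ≠ 0)
    {f : MvPolynomial (Fin n) ℂ} (hf : f.totalDegree ≤ ∑ i, d i)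
    (h0 : ∀ j, a j 0 = 0 → f.totalDegree < ∑ i, d i)
    (hv : ∀ j, a j 0 ≠ 0 → eval (fun i => a j i.succ / a j 0) f = 0) :
    f.coeff (Finsupp.equivFunOnFinite.symm (Fin.tail d)) = 0 := by
  classical
  have hdeg : ∀ m ∈ f.support, ∑ i, m i ≤ f.totalDegree := by
    intro m hm
    have := le_totalDegree hm
    rwa [Finsupp.sum_fintype _ _ (by simp)] at this
  set D := ∑ i, d i with hD
  -- The truncated subtraction in the homogenizing exponent is exact, since `|m| ≤ deg f ≤ D` on the
  -- support.
  have key : ∀ j, ∑ m ∈ f.support, f.coeff m *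
      ∏ i, a j i ^ (Fin.cons (D - ∑ i, m i) m : Fin (n + 1) → ℕ) i = 0 := by
    intro j
    simp only [Fin.prod_univ_succ, Fin.cons_zero, Fin.cons_succ]
    by_cases hj : a j 0 = 0
    · apply Finset.sum_eq_zero
      intro m hm
      have h1 := hdeg m hm
      have h2 := h0 j hj
      rw [hj, zero_pow (by omega)]
      simp
    · have h1 := hv j hj
      rw [eval_eq'] at h1
      rw [← mul_zero (a j 0 ^ D), ← h1, Finset.mul_sum]
      apply Finset.sum_congr rfl
      intro m hm
      have h2 := hdeg m hm
      have h3 : a j 0 ^ D = a j 0 ^ (D - ∑ i, m i) * ∏ i, a j 0 ^ m i := by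
        rw [Finset.prod_pow_eq_pow_sum, ← pow_add, Nat.sub_add_cancel (h2.trans hf)]
      rw [h3]
      simp only [div_pow, Finset.prod_div_distrib]
      have h4 : ∏ i, a j 0 ^ m i ≠ 0 := Finset.prod_ne_zero_iff.2 fun i _ => pow_ne_zero _ hj
      field_simp
  have h1 : ∑ m ∈ f.support, f.coeff m * (if (Fin.cons (D - ∑ i, m i) m : Fin (n + 1) → ℕ) = d
      then κ else 0) = 0 := by
    refine Eq.trans ?_ (Finset.sum_eq_zero (s := Finset.univ) fun j _ => key j)
    rw [Finset.sum_comm]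
    apply Finset.sum_congr rfl
    intro m hm
    rw [← Finset.mul_sum, ha]
    have h2 := (hdeg m hm).trans hf
    rw [Fin.sum_univ_succ]
    simp only [Fin.cons_zero, Fin.cons_succ]
    rw [Nat.sub_add_cancel h2, hD, Fin.sum_univ_succ]
  by_contra hne
  rw [Finset.sum_eq_single (Finsupp.equivFunOnFinite.symm (Fin.tail d))] at h1
  · rw [if_pos] at h1
    · exact mul_ne_zero hne hκ h1
    · have : D - ∑ i, Fin.tail d i = d 0 := by
        rw [hD, Fin.sum_univ_succ]
        simp [Fin.tail]
      simp only [Finsupp.equivFunOnFinite_symm_apply_apply, this]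
      exact Fin.cons_self_tail d
  · intro m _ hm
    rw [if_neg, mul_zero]
    intro h
    apply hm
    rw [← h, Fin.tail_cons]
    ext i
    simp
  · intro h
    rw [notMem_support_iff.1 h, zero_mul]

/-- The exponents bounded by the tail of `d`. -/
abbrev tailBox {n : ℕ} (d : Fin (n + 1) → ℕ) : Set (Fin n →₀ ℕ) :=
  Set.Iic (Finsupp.equivFunOnFinite.symm (Fin.tail d))

theorem sum_add_tail_sub {n : ℕ} {d : Fin (n + 1) → ℕ} {m : Fin n →₀ ℕ} (hm : m ∈ tailBox d) :
    ∑ i, m i + (Finsupp.equivFunOnFinite.symm (Fin.tail d) - m).sum (fun _ e => e) + d 0 =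
      ∑ i, d i := by
  rw [Finsupp.sum_fintype _ _ (by simp), ← Finset.sum_add_distrib, Fin.sum_univ_succ, add_comm]
  congr 1
  apply Finset.sum_congr rfl
  intro i _
  have := hm i
  simp [Fin.tail] at this ⊢
  omega

theorem exists_mem_support_sum_eq {σ : Type*} [Fintype σ] {f : MvPolynomial σ ℂ} (hf : f ≠ 0) :
    ∃ m ∈ f.support, ∑ i, m i = f.totalDegree := by
  obtain ⟨m, hm, h⟩ := Finset.exists_mem_eq_sup f.support (support_nonempty.2 hf)
    (fun s => s.sum fun _ e => e)
  refine ⟨m, hm, ?_⟩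
  rw [totalDegree, h, Finsupp.sum_fintype _ _ (by simp)]

/-- Multiplying by `z^(tail d - m)`, with `m` a top-degree exponent of `f`, places the coefficient
at `m` at `tail d`. The product has degree at most `∑ i, d i - d 0`, strictly below the threshold,
so points at infinity do no harm. -/
theorem HasMoments.eq_zero_of_eval {n : ℕ} {ι : Type*} [Fintype ι] {d : Fin (n + 1) → ℕ} {κ : ℂ}
    {a : ι → Fin (n + 1) → ℂ} (ha : HasMoments d κ a) (hκ : κ ≠ 0) (hd : 0 < d 0)
    {f : MvPolynomial (Fin n) ℂ} (hf : f ∈ restrictSupport ℂ (tailBox d))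
    (hv : ∀ j, a j 0 ≠ 0 → eval (fun i => a j i.succ / a j 0) f = 0) : f = 0 := by
  by_contra hne
  obtain ⟨m, hm, hdeg⟩ := exists_mem_support_sum_eq hne
  have hmb : m ∈ tailBox d := (mem_restrictSupport_iff ℂ).1 hf hm
  have hsum := sum_add_tail_sub hmb
  set s := Finsupp.equivFunOnFinite.symm (Fin.tail d) - m with hs
  have hlt : (f * monomial s 1).totalDegree < ∑ i, d i := by
    have h1 := totalDegree_mul f (monomial s 1)
    have h2 := totalDegree_monomial_le s (1 : ℂ)
    rw [Finsupp.sum_fintype _ _ (by simp)] at h2 hsum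
    simp only [id] at h2
    omega
  have := ha.coeff_eq_zero hκ hlt.le (fun _ _ => hlt) (fun j hj => by simp [hv j hj])
  rw [← add_tsub_cancel_of_le (show m ≤ _ from hmb), coeff_mul_monomial, mul_one] at this
  exact mem_support_iff.1 hm this

/-- Evaluation at finitely many points, on the polynomials with exponents in a given set. -/
def evalOn {σ ι : Type*} (s : Set (σ →₀ ℕ)) (b : ι → σ → ℂ) :
    restrictSupport ℂ s →ₗ[ℂ] (ι → ℂ) :=
  LinearMap.pi fun j => (aeval (b j)).toLinearMap ∘ₗ (restrictSupport ℂ s).subtype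

theorem evalOn_apply {σ ι : Type*} (s : Set (σ →₀ ℕ)) (b : ι → σ → ℂ)
    (f : restrictSupport ℂ s) (j : ι) : evalOn s b f j = eval (b j) (f : MvPolynomial σ ℂ) := by
  simp [evalOn, aeval_eq_eval]

theorem finrank_restrictSupport_tailBox {n : ℕ} (d : Fin (n + 1) → ℕ) :
    Module.finrank ℂ (restrictSupport ℂ (tailBox d)) = ∏ i : Fin n, (d i.succ + 1) := by
  classical
  rw [Module.finrank_eq_nat_card_basis (basisRestrictSupport ℂ (tailBox d)),
    Nat.card_coe_set_eq, tailBox, ← Finset.coe_Iic, Set.ncard_coe_finset, Finsupp.card_Iic]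
  rw [Finset.prod_subset (Finset.subset_univ _)]
  · simp [Fin.tail]
  · intro i _ hi
    simp at hi ⊢
    simp [hi]

instance {n : ℕ} (d : Fin (n + 1) → ℕ) : Module.Finite ℂ (restrictSupport ℂ (tailBox d)) := by
  have : Finite (tailBox d) := Set.finite_Iic _
  exact Module.Finite.of_basis (basisRestrictSupport ℂ (tailBox d))

theorem HasMoments.evalOn_injective {n : ℕ} {ι : Type*} [Fintype ι] {d : Fin (n + 1) → ℕ} {κ : ℂ}
    {a : ι → Fin (n + 1) → ℂ} (ha : HasMoments d κ a) (hκ : κ ≠ 0) (hd : 0 < d 0) :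
    Function.Injective (evalOn (tailBox d)
      fun (j : {j // a j 0 ≠ 0}) i => a j i.succ / a j 0) := by
  rw [← LinearMap.ker_eq_bot, LinearMap.ker_eq_bot']
  intro f hf
  apply Subtype.ext
  refine ha.eq_zero_of_eval hκ hd f.2 fun j hj => ?_
  have := congrFun hf ⟨j, hj⟩
  rwa [evalOn_apply] at this

theorem HasMoments.prod_le_card_subtype {n : ℕ} {ι : Type*} [Fintype ι] {d : Fin (n + 1) → ℕ}
    {κ : ℂ} {a : ι → Fin (n + 1) → ℂ} (ha : HasMoments d κ a) (hκ : κ ≠ 0) (hd : 0 < d 0) :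
    ∏ i : Fin n, (d i.succ + 1) ≤ Nat.card {j // a j 0 ≠ 0} := by
  classical
  have := LinearMap.finrank_le_finrank_of_injective (ha.evalOn_injective hκ hd)
  rwa [finrank_restrictSupport_tailBox, Module.finrank_fintype_fun_eq_card,
    ← Nat.card_eq_fintype_card] at this

theorem HasMoments.prod_le_card {n : ℕ} {ι : Type*} [Fintype ι] {d : Fin (n + 1) → ℕ}
    {κ : ℂ} {a : ι → Fin (n + 1) → ℂ} (ha : HasMoments d κ a) (hκ : κ ≠ 0) (hd : 0 < d 0) :
    ∏ i : Fin n, (d i.succ + 1) ≤ Nat.card ι :=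
  (ha.prod_le_card_subtype hκ hd).trans
    (Nat.card_le_card_of_injective _ Subtype.val_injective)

theorem HasMoments.apply_zero_ne_zero {n : ℕ} {ι : Type*} [Fintype ι] {d : Fin (n + 1) → ℕ}
    {κ : ℂ} {a : ι → Fin (n + 1) → ℂ} (ha : HasMoments d κ a) (hκ : κ ≠ 0) (hd : 0 < d 0)
    (hcard : Nat.card ι = ∏ i : Fin n, (d i.succ + 1)) (j : ι) : a j 0 ≠ 0 := by
  have h1 := ha.prod_le_card_subtype hκ hd
  rw [← hcard] at h1
  have h2 : Function.Surjective (Subtype.val : {j // a j 0 ≠ 0} → ι) :=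
    (Subtype.val_injective.bijective_of_nat_card_le h1).2
  obtain ⟨x, rfl⟩ := h2 j
  exact x.2

/-- With the minimal number of points, evaluation is an injection between spaces of equal dimension,
hence interpolation is possible. -/
theorem HasMoments.exists_eval_eq {n : ℕ} {ι : Type*} [Fintype ι] {d : Fin (n + 1) → ℕ}
    {κ : ℂ} {a : ι → Fin (n + 1) → ℂ} (ha : HasMoments d κ a) (hκ : κ ≠ 0) (hd : 0 < d 0)
    (hcard : Nat.card ι = ∏ i : Fin n, (d i.succ + 1)) (v : ι → ℂ) :
    ∃ f ∈ restrictSupport ℂ (tailBox d), ∀ j, eval (fun i => a j i.succ / a j 0) f = v j := by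
  classical
  have hinj := ha.evalOn_injective hκ hd
  have h1 : Nat.card {j // a j 0 ≠ 0} = ∏ i : Fin n, (d i.succ + 1) :=
    le_antisymm (hcard ▸ Nat.card_le_card_of_injective _ Subtype.val_injective)
      (ha.prod_le_card_subtype hκ hd)
  have hsurj := (LinearMap.injective_iff_surjective_of_finrank_eq_finrank (by
    rw [finrank_restrictSupport_tailBox, Module.finrank_fintype_fun_eq_card,
      ← Nat.card_eq_fintype_card, h1])).1 hinj
  obtain ⟨f, hf⟩ := hsurj fun j => v j
  refine ⟨f, f.2, fun j => ?_⟩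
  have := congrFun hf ⟨j, ha.apply_zero_ne_zero hκ hd hcard j⟩
  rwa [evalOn_apply] at this

/-! ### Affine points of the projective space of linear forms -/

theorem ofCoords_cons_ne_zero {n : ℕ} (z : Fin n → ℂ) : ofCoords (Fin.cons 1 z) ≠ 0 := by
  intro h
  have := congrFun (congrArg coords h) 0
  simp [coords_ofCoords, coords_zero] at this

/-- The point `[x₀ + z₁ x₁ + ⋯ + zₙ xₙ]`. -/
def affinePoint {n : ℕ} (z : Fin n → ℂ) : PLin n :=
  Projectivization.mk ℂ (ofCoords (Fin.cons 1 z)) (ofCoords_cons_ne_zero z)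

theorem mk_eq_affinePoint_iff {n : ℕ} {l : LinForm n} (hl : l ≠ 0) (z : Fin n → ℂ) :
    Projectivization.mk ℂ l hl = affinePoint z ↔
      coords l 0 ≠ 0 ∧ ∀ i : Fin n, coords l i.succ = coords l 0 * z i := by
  rw [affinePoint, Projectivization.mk_eq_mk_iff']
  constructor
  · rintro ⟨c, rfl⟩
    have hc : c ≠ 0 := by rintro rfl; simp at hl
    simp [coords_smul, coords_ofCoords, hc]
  · rintro ⟨-, h⟩
    refine ⟨coords l 0, coords_injective ?_⟩
    rw [coords_smul, coords_ofCoords]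
    funext i
    refine Fin.cases ?_ (fun i => ?_) i
    · simp
    · simp [h]

theorem mk_eq_affinePoint {n : ℕ} {l : LinForm n} (hl : l ≠ 0) (h0 : coords l 0 ≠ 0) :
    Projectivization.mk ℂ l hl = affinePoint fun i => coords l i.succ / coords l 0 := by
  rw [mk_eq_affinePoint_iff]
  exact ⟨h0, fun i => by field_simp⟩

theorem affinePoint_injective {n : ℕ} : Function.Injective (affinePoint (n := n)) := by
  intro y z h
  have := ((mk_eq_affinePoint_iff (ofCoords_cons_ne_zero y) z).1 h).2
  funext i
  simpa [coords_ofCoords] using this i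

theorem smul_affinePoint {n : ℕ} (t : BigTorus n) (z : Fin n → ℂ) :
    t • affinePoint z = affinePoint fun i => (t i.succ : ℂ) / t 0 * z i := by
  rw [affinePoint, Projectivization.smul_mk, mk_eq_affinePoint_iff]
  simp only [coords_torus_smul, coords_ofCoords, Fin.cons_zero, Fin.cons_succ]
  refine ⟨by simp, fun i => ?_⟩
  have := (t 0).ne_zero
  field_simp

/-! ### The Waring rank of a monomial -/

/-- A quadrature formula with nodes `S` and weights `w` which picks out the coefficient of `zᵉ`
from polynomials of degree at most `e + s`. -/
structure IsQuadrature (e s : ℕ) (S : Finset ℂ) (w : ℂ → ℂ) : Prop where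
  card_eq : S.card = e + 1
  weight_ne_zero : ∀ z ∈ S, w z ≠ 0
  sum_eq : ∀ m ≤ e + s, ∑ z ∈ S, w z * z ^ m = if m = e then 1 else 0

theorem sum_nthRootsFinset_pow {N : ℕ} (hN : 0 < N) (m : ℕ) :
    ∑ z ∈ Polynomial.nthRootsFinset N (1 : ℂ), z ^ m = if N ∣ m then (N : ℂ) else 0 := by
  have hζ := Complex.isPrimitiveRoot_exp N hN.ne'
  set ζ := Complex.exp (2 * Real.pi * Complex.I / N)
  have hζ0 : ζ ≠ 0 := hζ.ne_zero hN.ne'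
  split_ifs with h
  · rw [Finset.sum_eq_card_nsmul (b := 1), hζ.card_nthRootsFinset, nsmul_eq_mul, mul_one]
    intro z hz
    rw [Polynomial.mem_nthRootsFinset hN] at hz
    obtain ⟨q, rfl⟩ := h
    rw [pow_mul, hz, one_pow]
  · have hne : ζ ^ m ≠ 1 := fun h1 => h ((hζ.pow_eq_one_iff_dvd m).1 h1)
    have hinv : ζ ^ m * ∑ z ∈ Polynomial.nthRootsFinset N (1 : ℂ), z ^ m =
        ∑ z ∈ Polynomial.nthRootsFinset N (1 : ℂ), z ^ m := by
      rw [Finset.mul_sum]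
      refine Finset.sum_bij' (fun z _ => ζ * z) (fun z _ => ζ⁻¹ * z) ?_ ?_ ?_ ?_ ?_
      · intro z hz
        rw [Polynomial.mem_nthRootsFinset hN] at hz ⊢
        rw [mul_pow, hz, hζ.pow_eq_one, one_mul]
      · intro z hz
        rw [Polynomial.mem_nthRootsFinset hN] at hz ⊢
        rw [mul_pow, hz, inv_pow, hζ.pow_eq_one, inv_one, one_mul]
      · intro z _
        simp [hζ0]
      · intro z _
        simp [hζ0]
      · intro z _
        rw [mul_pow]
    have : (ζ ^ m - 1) * ∑ z ∈ Polynomial.nthRootsFinset N (1 : ℂ), z ^ m = 0 := by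
      rw [sub_mul, hinv, one_mul, sub_self]
    exact (mul_eq_zero.1 this).resolve_left (sub_ne_zero.2 hne)

/-- Take the `(e+1)`-th roots of unity with weights `z / (e+1)`: the sum is nonzero only if `e+1`
divides `m+1`, and `m + 1 ≤ 2e + 1` leaves only `m = e`. -/
theorem exists_isQuadrature {e s : ℕ} (hse : s ≤ e) :
    ∃ S w, IsQuadrature e s S w ∧ (0 : ℂ) ∉ S := by
  have hN : 0 < e + 1 := e.succ_pos
  have hN' : ((e + 1 : ℕ) : ℂ) ≠ 0 := Nat.cast_ne_zero.2 hN.ne'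
  have hz0 : ∀ z ∈ Polynomial.nthRootsFinset (e + 1) (1 : ℂ), z ≠ 0 := by
    rintro z hz rfl
    rw [Polynomial.mem_nthRootsFinset hN] at hz
    simp at hz
  refine ⟨Polynomial.nthRootsFinset (e + 1) 1, fun z => z / (e + 1 : ℕ), ⟨?_, ?_, ?_⟩,
    fun h => hz0 0 h rfl⟩
  · exact (Complex.isPrimitiveRoot_exp _ hN.ne').card_nthRootsFinset
  · exact fun z hz => div_ne_zero (hz0 z hz) hN'
  · intro m hm
    have h1 : ∀ z : ℂ, z / (e + 1 : ℕ) * z ^ m = z ^ (m + 1) / (e + 1 : ℕ) := by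
      intro z
      ring
    simp only [h1]
    rw [← Finset.sum_div, sum_nthRootsFinset_pow hN]
    by_cases hme : m = e
    · subst hme
      simp only [dvd_refl, if_true]
      exact div_self hN'
    · rw [if_neg, if_neg hme, zero_div]
      rintro ⟨q, hq⟩
      obtain rfl | rfl | h2 : q = 0 ∨ q = 1 ∨ 2 ≤ q := by omega
      · omega
      · omega
      · nlinarith

/-- The averaged `e`-th roots of unity also detect `m = 0`; the node `0` with weight `-1` cancels
this. The next multiple `2e` is out of range since `s < e`. -/
theorem exists_isQuadrature_zero_mem {e s : ℕ} (hse : s < e) :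
    ∃ S w, IsQuadrature e s S w ∧ (0 : ℂ) ∈ S := by
  have hN : 0 < e := by omega
  have hN' : (e : ℂ) ≠ 0 := Nat.cast_ne_zero.2 hN.ne'
  have h0 : (0 : ℂ) ∉ Polynomial.nthRootsFinset e (1 : ℂ) := by
    rw [Polynomial.mem_nthRootsFinset hN]
    simp [hN.ne']
  refine ⟨Finset.cons 0 _ h0, fun z => if z = 0 then -1 else 1 / (e : ℂ), ⟨?_, ?_, ?_⟩,
    Finset.mem_cons_self _ _⟩
  · rw [Finset.card_cons, (Complex.isPrimitiveRoot_exp _ hN.ne').card_nthRootsFinset]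
  · intro z _
    split_ifs <;> simp [hN']
  · intro m hm
    rw [Finset.sum_cons]
    have h1 : ∀ z ∈ Polynomial.nthRootsFinset e (1 : ℂ),
        (if z = 0 then -1 else 1 / (e : ℂ)) * z ^ m = z ^ m / e := by
      intro z hz
      rw [if_neg (by rintro rfl; exact h0 hz)]
      ring
    rw [Finset.sum_congr rfl h1, ← Finset.sum_div, sum_nthRootsFinset_pow hN]
    obtain rfl | hm0 := Nat.eq_zero_or_pos m
    · simp [hN', hN.ne]
    · rw [zero_pow hm0.ne', mul_zero, zero_add]
      by_cases hme : m = e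
      · subst hme
        simp [hN']
      · rw [if_neg, if_neg hme, zero_div]
        rintro ⟨q, rfl⟩
        obtain rfl | rfl | h2 : q = 0 ∨ q = 1 ∨ 2 ≤ q := by omega
        · omega
        · omega
        · nlinarith

theorem exists_hasMoments_of_isQuadrature {n : ℕ} {d : Fin (n + 1) → ℕ} (hd : 0 < d 0)
    {S : Fin n → Finset ℂ} {w : Fin n → ℂ → ℂ}
    (hS : ∀ i, IsQuadrature (d i.succ) (d 0) (S i) (w i)) (κ : ℂ) (hκ : κ ≠ 0) :
    ∃ ρ : Fintype.piFinset S → ℂ, (∀ z, ρ z ≠ 0) ∧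
      HasMoments d κ fun z => ρ z • (Fin.cons 1 z.1 : Fin (n + 1) → ℂ) := by
  have hD : 0 < ∑ i, d i := hd.trans_le (Finset.single_le_sum (fun _ _ => Nat.zero_le _)
    (Finset.mem_univ 0))
  -- All moments used have the same degree, so a root of that order absorbs the weight of a node
  -- into its linear form.
  choose ρ hρ using fun z : Fintype.piFinset S =>
    IsAlgClosed.exists_pow_nat_eq (κ * ∏ i, w i (z.1 i)) hD
  refine ⟨ρ, fun z h => ?_, fun m hm => ?_⟩
  · have h1 := hρ z
    rw [h, zero_pow hD.ne'] at h1
    refine mul_ne_zero hκ (Finset.prod_ne_zero_iff.2 fun i _ => ?_) h1.symm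
    exact (hS i).weight_ne_zero _ (Fintype.mem_piFinset.1 z.2 i)
  · have h1 : ∀ z : Fintype.piFinset S,
        ∏ i, (ρ z • (Fin.cons 1 z.1 : Fin (n + 1) → ℂ)) i ^ m i =
          κ * ∏ i, (w i (z.1 i) * z.1 i ^ m i.succ) := by
      intro z
      simp only [Pi.smul_apply, smul_eq_mul, mul_pow, Finset.prod_mul_distrib]
      rw [Finset.prod_pow_eq_pow_sum, hm, hρ, Fin.prod_univ_succ]
      simp [mul_assoc]
    simp only [h1, ← Finset.mul_sum]
    rw [Finset.sum_coe_sort (Fintype.piFinset S)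
      (fun z => ∏ i, (w i (z i) * z i ^ m i.succ)),
      ← Finset.prod_univ_sum S fun i z => w i z * z ^ m i.succ]
    rw [Fin.sum_univ_succ, Fin.sum_univ_succ] at hm
    -- One low exponent kills its factor. If there is none, the excesses over `d` total at most `d
    -- 0`, so every exponent lies in the range of its quadrature rule.
    by_cases hlt : ∃ i : Fin n, m i.succ < d i.succ
    · obtain ⟨i, hi⟩ := hlt
      rw [Finset.prod_eq_zero (Finset.mem_univ i), mul_zero, if_neg]
      · rintro rfl
        exact hi.false
      · rw [(hS i).sum_eq _ (by omega), if_neg hi.ne]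
    · push Not at hlt
      have hle : ∀ i : Fin n, m i.succ ≤ d i.succ + d 0 := by
        intro i
        have h2 := Finset.add_sum_erase Finset.univ (fun i : Fin n => m i.succ)
          (Finset.mem_univ i)
        have h3 := Finset.add_sum_erase Finset.univ (fun i : Fin n => d i.succ)
          (Finset.mem_univ i)
        have h4 : ∑ i ∈ Finset.univ.erase i, d i.succ ≤ ∑ i ∈ Finset.univ.erase i, m i.succ :=
          Finset.sum_le_sum fun i _ => hlt i
        omega
      rw [Finset.prod_congr rfl fun i _ => (hS i).sum_eq _ (hle i)]
      split_ifs with hmd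
      · subst hmd
        simp
      · obtain ⟨i, hi⟩ : ∃ i : Fin n, m i.succ ≠ d i.succ := by
          by_contra! h
          apply hmd
          funext i
          refine Fin.cases ?_ h i
          rw [Finset.sum_congr rfl fun i _ => h i] at hm
          omega
        rw [Finset.prod_eq_zero (Finset.mem_univ i) (if_neg hi), mul_zero]

theorem exists_decomposition_of_isQuadrature {n : ℕ} {d : Fin (n + 1) → ℕ} (hd : 0 < d 0)
    {S : Fin n → Finset ℂ} {w : Fin n → ℂ → ℂ}
    (hS : ∀ i, IsQuadrature (d i.succ) (d 0) (S i) (w i)) :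
    affinePoint '' {z | ∀ i, z i ∈ S i} ∈
      VSPo (∑ i, d i) (∏ i : Fin n, (d i.succ + 1)) (monomialForm d) := by
  obtain ⟨ρ, hρ, hm⟩ := exists_hasMoments_of_isQuadrature hd hS (multinomialCoeff d)⁻¹
    (inv_ne_zero (multinomialCoeff_ne_zero d))
  have hcard : Fintype.card (Fintype.piFinset S) = ∏ i : Fin n, (d i.succ + 1) := by
    rw [Fintype.card_coe, Fintype.card_piFinset]
    exact Finset.prod_congr rfl fun i _ => (hS i).card_eq
  let E := (Fintype.equivFinOfCardEq hcard).symm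
  let l : Fintype.piFinset S → LinForm n := fun z => ρ z • ofCoords (Fin.cons 1 z.1)
  have hl : ∀ z, l z ≠ 0 := fun z => smul_ne_zero (hρ z) (ofCoords_cons_ne_zero _)
  have hmk : ∀ z, Projectivization.mk ℂ (l z) (hl z) = affinePoint z.1 := by
    intro z
    rw [mk_eq_affinePoint_iff]
    simp [l, coords_smul, coords_ofCoords, hρ]
  refine ⟨fun j => l (E j), fun j => hl (E j), ?_, ?_, ?_⟩
  · simp only [hmk]
    exact affinePoint_injective.comp (Subtype.val_injective.comp E.injective)
  · simp only [hmk]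
    rw [show (fun j => affinePoint (E j).1) = (fun z => affinePoint z.1) ∘ E from rfl,
      E.surjective.range_comp]
    ext p
    simp [Fintype.mem_piFinset]
  · rw [Equiv.sum_comp E fun z => (l z : Poly n) ^ ∑ i, d i, monomialForm_eq_sum_iff]
    simpa only [l, coords_smul, coords_ofCoords] using hm

theorem waringRank_monomialForm {n : ℕ} {d : Fin (n + 1) → ℕ} (hd : 0 < d 0)
    (hmono : Monotone d) :
    waringRank (∑ i, d i) (monomialForm d) = ∏ i : Fin n, (d i.succ + 1) := by
  choose S w hS _ using fun i : Fin n =>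
    exists_isQuadrature (s := d 0) (e := d i.succ) (hmono (Fin.zero_le _))
  obtain ⟨l, _, _, _, hF⟩ := exists_decomposition_of_isQuadrature hd hS
  refine le_antisymm (Nat.sInf_le ⟨l, hF⟩) (le_csInf ⟨_, l, hF⟩ ?_)
  rintro r ⟨l, hF⟩
  simpa using ((monomialForm_eq_sum_iff d l).1 hF).prod_le_card
    (inv_ne_zero (multinomialCoeff_ne_zero d)) hd

/-! ### Non-emptiness, and failure of transitivity for unequal exponents. -/

theorem mem_VSPmono_iff {n : ℕ} {d : Fin (n + 1) → ℕ} (hd : 0 < d 0) (hmono : Monotone d)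
    {Q : Set (PLin n)} : Q ∈ VSPmono d ↔
      Q ∈ VSPo (∑ i, d i) (∏ i : Fin n, (d i.succ + 1)) (monomialForm d) := by
  rw [← waringRank_monomialForm hd hmono]
  rfl

theorem VSPmono_nonempty {n : ℕ} {d : Fin (n + 1) → ℕ} (hd : 0 < d 0) (hmono : Monotone d) :
    (VSPmono d : Set (Set (PLin n))).Nonempty := by
  choose S w hS _ using fun i : Fin n =>
    exists_isQuadrature (s := d 0) (e := d i.succ) (hmono (Fin.zero_le _))
  exact ⟨_, (mem_VSPmono_iff hd hmono).2 (exists_decomposition_of_isQuadrature hd hS)⟩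

theorem eq_of_isPretransitive {n : ℕ} {d : Fin (n + 1) → ℕ} (hd : 0 < d 0) (hmono : Monotone d)
    (htrans : MulAction.IsPretransitive (torus d) (VSPmono d)) (i : Fin (n + 1)) :
    d i = d 0 := by
  induction i using Fin.cases with
  | zero => rfl
  | succ i =>
    by_contra hne
    have hlt : d 0 < d i.succ := lt_of_le_of_ne (hmono (Fin.zero_le _)) (Ne.symm hne)
    choose S w hS hS0 using fun i : Fin n =>
      exists_isQuadrature (s := d 0) (e := d i.succ) (hmono (Fin.zero_le _))
    obtain ⟨S₁, w₁, hS₁, h0⟩ := exists_isQuadrature_zero_mem hlt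
    -- Only the `i`-th rule is replaced, by one with node `0`; the original decomposition has no
    -- point with `i`-th affine coordinate zero.
    have hS' : ∀ j, IsQuadrature (d j.succ) (d 0) (Function.update S i S₁ j)
        (Function.update w i w₁ j) := by
      intro j
      by_cases hj : j = i
      · subst hj
        simpa using hS₁
      · simpa [hj] using hS j
    have hQ := (mem_VSPmono_iff hd hmono).2 (exists_decomposition_of_isQuadrature hd hS)
    have hQ' := (mem_VSPmono_iff hd hmono).2 (exists_decomposition_of_isQuadrature hd hS')
    obtain ⟨t, ht⟩ := htrans.exists_smul_eq ⟨_, hQ⟩ ⟨_, hQ'⟩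
    have ht' : (t : BigTorus n) • affinePoint '' {z | ∀ i, z i ∈ S i} =
        affinePoint '' {z | ∀ j, z j ∈ Function.update S i S₁ j} := congrArg Subtype.val ht
    have hne : ∀ j, (S j).Nonempty := fun j => Finset.card_pos.1 (by rw [(hS j).card_eq]; omega)
    choose z hz using hne
    have hmem : affinePoint (Function.update z i 0) ∈
        affinePoint '' {z | ∀ j, z j ∈ Function.update S i S₁ j} := by
      refine ⟨_, fun j => ?_, rfl⟩
      by_cases hj : j = i
      · subst hj
        simpa using h0
      · simpa [hj] using hz j
    rw [← ht'] at hmem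
    obtain ⟨_, ⟨y, hy, rfl⟩, hty⟩ := hmem
    dsimp only at hty
    rw [smul_affinePoint] at hty
    have h1 := congrFun (affinePoint_injective hty) i
    have h2 : y i ≠ 0 := fun h => hS0 i (h ▸ hy i)
    simp [h2] at h1

/-! ### Minimal decompositions of a monomial with equal exponents -/

theorem exists_hasMoments_of_mem_VSPo {n : ℕ} {d : Fin (n + 1) → ℕ} (hd : 0 < d 0)
    {Q : Set (PLin n)}
    (hQ : Q ∈ VSPo (∑ i, d i) (∏ i : Fin n, (d i.succ + 1)) (monomialForm d)) :
    ∃ a : Fin (∏ i : Fin n, (d i.succ + 1)) → Fin (n + 1) → ℂ,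
      HasMoments d (multinomialCoeff d)⁻¹ a ∧ (∀ j, a j 0 ≠ 0) ∧
      Function.Injective (fun j (i : Fin n) => a j i.succ / a j 0) ∧
      Q = affinePoint '' Set.range fun j (i : Fin n) => a j i.succ / a j 0 := by
  obtain ⟨l, hl, hinj, rfl, hF⟩ := hQ
  have ha := (monomialForm_eq_sum_iff d l).1 hF
  have h0 := ha.apply_zero_ne_zero (inv_ne_zero (multinomialCoeff_ne_zero d)) hd (by simp)
  have hmk := fun j => mk_eq_affinePoint (hl j) (h0 j)
  simp only [hmk] at hinj ⊢
  exact ⟨fun j => coords (l j), ha, h0, Function.Injective.of_comp (f := affinePoint) hinj,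
    Set.range_comp affinePoint _⟩

/-- Let `p` interpolate `zᵢ^(k+1)` in the box. If `p` had positive degree, shifting a top term of
`zᵢ^(k+1) - p` to `tail d` would contradict `HasMoments.coeff_eq_zero`. -/
theorem HasMoments.exists_pow_eq {n k : ℕ} {ι : Type*} [Fintype ι] {κ : ℂ}
    {a : ι → Fin (n + 1) → ℂ} (ha : HasMoments (fun _ => k) κ a) (hκ : κ ≠ 0) (hk : 0 < k)
    (hcard : Nat.card ι = ∏ _i : Fin n, (k + 1)) (i : Fin n) :
    ∃ c : ℂ, c ≠ 0 ∧ ∀ j, (a j i.succ / a j 0) ^ (k + 1) = c := by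
  have h0 := ha.apply_zero_ne_zero hκ hk hcard
  obtain ⟨p, hp, hpv⟩ := ha.exists_eval_eq hκ hk hcard fun j => (a j i.succ / a j 0) ^ (k + 1)
  have hdeg : p.totalDegree = 0 := by
    by_contra hne
    have hp0 : p ≠ 0 := by
      rintro rfl
      simp at hne
    obtain ⟨m, hm, hmdeg⟩ := exists_mem_support_sum_eq hp0
    have hmb : m ∈ tailBox fun _ : Fin (n + 1) => k := (mem_restrictSupport_iff ℂ).1 hp hm
    have hsum := sum_add_tail_sub hmb
    set s := Finsupp.equivFunOnFinite.symm (Fin.tail fun _ : Fin (n + 1) => k) - m with hs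
    have hle : ((X i ^ (k + 1) - p) * monomial s 1).totalDegree ≤ ∑ _i : Fin (n + 1), k := by
      have h1 := totalDegree_mul (X i ^ (k + 1) - p) (monomial s 1)
      have h2 := totalDegree_monomial_le s (1 : ℂ)
      have h3 := totalDegree_sub (X i ^ (k + 1)) p
      rw [totalDegree_X_pow] at h3
      rw [Finsupp.sum_fintype _ _ (by simp)] at h2 hsum
      simp only [id] at h2
      -- Positivity of the degree of `p` enters here. The resulting bound is not strict, so the
      -- absence of points at infinity is needed below.
      have h4 : max (k + 1) p.totalDegree ≤ p.totalDegree + k := max_le (by omega) (by omega)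
      omega
    have h1 := ha.coeff_eq_zero hκ hle (fun j hj => absurd hj (h0 j))
      (fun j _ => by simp [hpv j])
    rw [← add_tsub_cancel_of_le (show m ≤ _ from hmb), coeff_mul_monomial, mul_one, coeff_sub,
      coeff_X_pow, if_neg, zero_sub, neg_eq_zero] at h1
    · exact mem_support_iff.1 hm h1
    · rintro rfl
      have := hmb i
      simp [Fin.tail] at this
  rw [totalDegree_eq_zero_iff_eq_C] at hdeg
  refine ⟨p.coeff 0, fun hc => ?_, fun j => ?_⟩
  · rw [hc, map_zero] at hdeg
    -- If the constant were zero, `zᵢ` would vanish at every node, although it lies in the box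
    -- because `k ≥ 1`.
    have hX : (X i : MvPolynomial (Fin n) ℂ) = 0 := by
      refine ha.eq_zero_of_eval hκ hk ?_ fun j _ => ?_
      · rw [X, monomial_mem_restrictSupport]
        left
        rw [Set.mem_Iic, Finsupp.single_le_iff]
        simpa [Fin.tail] using Nat.succ_le_of_lt hk
      · have h1 := hpv j
        rw [hdeg, map_zero] at h1
        rw [eval_X]
        exact pow_eq_zero_iff (Nat.succ_ne_zero k) |>.1 h1.symm
    exact X_ne_zero i hX
  · rw [← hpv j, hdeg]
    simp

/-- The points `z` with `zᵢᵏ⁺¹ = cᵢ` for all `i`. -/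
def powerPoints {n : ℕ} (k : ℕ) (c : Fin n → ℂ) : Set (Fin n → ℂ) :=
  {z | ∀ i, z i ^ (k + 1) = c i}

theorem exists_eq_powerPoints {n k : ℕ} (hk : 0 < k) {Q : Set (PLin n)}
    (hQ : Q ∈ VSPo (∑ _i : Fin (n + 1), k) (∏ _i : Fin n, (k + 1)) (monomialForm fun _ => k)) :
    ∃ c : Fin n → ℂ, (∀ i, c i ≠ 0) ∧ Q = affinePoint '' powerPoints k c := by
  classical
  obtain ⟨a, ha, h0, hinj, rfl⟩ := exists_hasMoments_of_mem_VSPo (d := fun _ => k) hk hQ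
  choose c hc hac using
    ha.exists_pow_eq (inv_ne_zero (multinomialCoeff_ne_zero _)) hk (by simp)
  refine ⟨c, hc, congrArg _ ?_⟩
  have hset : powerPoints k c =
      Fintype.piFinset fun i => (Polynomial.nthRootsFinset (k + 1) (c i)) := by
    ext z
    simp [powerPoints]
  -- The nodes are `(k+1)^n` distinct solutions, and the equations have at most that many.
  refine Set.eq_of_subset_of_ncard_le ?_ ?_ ?_
  · rintro _ ⟨j, rfl⟩ i
    exact hac i j
  · rw [← Set.image_univ, Set.ncard_image_of_injective _ hinj, Set.ncard_univ, Nat.card_fin,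
      hset, Set.ncard_coe_finset, Fintype.card_piFinset]
    refine Finset.prod_le_prod' fun i _ => ?_
    rw [Polynomial.nthRootsFinset_def]
    exact (Multiset.toFinset_card_le _).trans (Polynomial.card_nthRoots _ _)
  · rw [hset]
    exact Finset.finite_toSet _

theorem torus_smul_powerPoints {n k : ℕ} (t : BigTorus n) (c : Fin n → ℂ) :
    t • affinePoint '' powerPoints k c =
      affinePoint '' powerPoints k fun i => ((t i.succ : ℂ) / t 0) ^ (k + 1) * c i := by
  have h0 := (t 0).ne_zero
  have hi := fun i : Fin n => (t i.succ).ne_zero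
  rw [← Set.image_smul, Set.image_image]
  simp only [smul_affinePoint]
  ext p
  constructor
  · rintro ⟨z, hz, rfl⟩
    refine ⟨_, fun i => ?_, rfl⟩
    rw [mul_pow, hz i]
  · rintro ⟨z, hz, rfl⟩
    refine ⟨fun i => (t 0 : ℂ) / t i.succ * z i, fun i => ?_, ?_⟩
    · have := hi i
      rw [mul_pow, hz i, ← mul_assoc, ← mul_pow, div_mul_div_cancel₀ this, div_self h0, one_pow,
        one_mul]
    · dsimp only
      congr 1
      funext i
      have := hi i
      field_simp

/-- Only the ratios `μᵢ = tᵢ / t₀` matter for the nodes; they are `(k+1)`-th roots of `c'ᵢ / cᵢ`.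
The free common factor `x` is then chosen to make `∏ tᵢ = 1`. -/
theorem exists_torus_smul_powerPoints_eq {n : ℕ} (k : ℕ) {c c' : Fin n → ℂ}
    (hc : ∀ i, c i ≠ 0) (hc' : ∀ i, c' i ≠ 0) :
    ∃ t ∈ torus fun _ : Fin (n + 1) => k,
      t • affinePoint '' powerPoints k c = affinePoint '' powerPoints k c' := by
  choose μ hμ using fun i => IsAlgClosed.exists_pow_nat_eq (c' i / c i) k.succ_pos
  have hμ0 : ∀ i, μ i ≠ 0 := by
    intro i h
    have := hμ i
    rw [h, zero_pow (Nat.succ_ne_zero k)] at this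
    exact div_ne_zero (hc' i) (hc i) this.symm
  obtain ⟨x, hx⟩ := IsAlgClosed.exists_pow_nat_eq (∏ i, μ i)⁻¹ n.succ_pos
  have hμp : ∏ i, μ i ≠ 0 := Finset.prod_ne_zero_iff.2 fun i _ => hμ0 i
  have hx0 : x ≠ 0 := by
    rintro rfl
    rw [zero_pow (Nat.succ_ne_zero n)] at hx
    exact inv_ne_zero hμp hx.symm
  refine ⟨Fin.cons (Units.mk0 x hx0) fun i => Units.mk0 (x * μ i) (mul_ne_zero hx0 (hμ0 i)),
    ?_, ?_⟩
  · change ∏ i, _ = 1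
    rw [Finset.prod_pow, Fin.prod_univ_succ]
    apply Units.ext
    simp only [Fin.cons_zero, Fin.cons_succ, Units.val_pow_eq_pow_val, Units.val_mul,
      Units.coe_prod, Units.val_mk0, Units.val_one]
    rw [Finset.prod_mul_distrib, Finset.prod_const, Finset.card_univ, Fintype.card_fin,
      ← mul_assoc, ← pow_succ', hx, inv_mul_cancel₀ hμp, one_pow]
  · rw [torus_smul_powerPoints]
    congr 2
    funext i
    simp only [Fin.cons_zero, Fin.cons_succ, Units.val_mk0]
    rw [mul_div_cancel_left₀ _ hx0, hμ, div_mul_cancel₀ _ (hc i)]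

theorem isPretransitive_of_eq {n k : ℕ} (hk : 0 < k) :
    MulAction.IsPretransitive (torus fun _ : Fin (n + 1) => k)
      (VSPmono fun _ : Fin (n + 1) => k) := by
  refine ⟨fun Q Q' => ?_⟩
  obtain ⟨c, hc, hQ⟩ := exists_eq_powerPoints hk ((mem_VSPmono_iff hk monotone_const).1 Q.2)
  obtain ⟨c', hc', hQ'⟩ := exists_eq_powerPoints hk ((mem_VSPmono_iff hk monotone_const).1 Q'.2)
  obtain ⟨t, ht, h⟩ := exists_torus_smul_powerPoints_eq k hc hc'
  have hQQ' : t • (Q : Set (PLin n)) = Q' := by rw [hQ, h, hQ']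
  exact ⟨⟨t, ht⟩, Subtype.ext hQQ'⟩

/-! ### The ideal of a minimal decomposition -/

/-- Homogenization to degree `e` of polynomials in `n` variables. -/
def homogenizeTo (n e : ℕ) : MvPolynomial (Fin n) ℂ →ₗ[ℂ] Poly n :=
  (basisMonomials (Fin n) ℂ).constr ℂ fun m => X 0 ^ (e - ∑ i, m i) * ∏ i, X i.succ ^ m i

theorem homogenizeTo_monomial {n : ℕ} (e : ℕ) (m : Fin n →₀ ℕ) (r : ℂ) :
    homogenizeTo n e (monomial m r) =
      C r * (X 0 ^ (e - ∑ i, m i) * ∏ i, X i.succ ^ m i) := by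
  have h : (monomial m r : MvPolynomial (Fin n) ℂ) = r • basisMonomials (Fin n) ℂ m := by
    simp [smul_monomial]
  rw [h, map_smul, homogenizeTo, Module.Basis.constr_basis, smul_eq_C_mul]

/-- The remainders of the exponents of `x₁, …, xₙ` modulo `k + 1`. -/
def tailMod {n : ℕ} (k : ℕ) (m : Fin (n + 1) →₀ ℕ) : Fin n →₀ ℕ :=
  Finsupp.equivFunOnFinite.symm fun i => m i.succ % (k + 1)

theorem tailMod_apply {n : ℕ} (k : ℕ) (m : Fin (n + 1) →₀ ℕ) (i : Fin n) :
    tailMod k m i = m i.succ % (k + 1) := rfl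

/-- The dehomogenization of `g`, reduced modulo the relations `zᵢᵏ⁺¹ = cᵢ`. -/
def reducedDehomogenization {n : ℕ} (k : ℕ) (c : Fin n → ℂ) (g : Poly n) :
    MvPolynomial (Fin n) ℂ :=
  ∑ m ∈ g.support, monomial (tailMod k m) (g.coeff m * ∏ i, c i ^ (m i.succ / (k + 1)))

theorem reducedDehomogenization_mem {n : ℕ} (k : ℕ) (c : Fin n → ℂ) (g : Poly n) :
    reducedDehomogenization k c g ∈ restrictSupport ℂ (tailBox fun _ : Fin (n + 1) => k) := by
  refine Submodule.sum_mem _ fun m _ => ?_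
  rw [monomial_mem_restrictSupport]
  left
  intro i
  simpa [tailMod_apply, Fin.tail] using Nat.lt_succ_iff.1 (Nat.mod_lt (m i.succ) k.succ_pos)

theorem eval_reducedDehomogenization {n k : ℕ} {c z : Fin n → ℂ} (hz : z ∈ powerPoints k c)
    (g : Poly n) : eval z (reducedDehomogenization k c g) = eval (Fin.cons 1 z) g := by
  rw [reducedDehomogenization, map_sum, eval_eq']
  refine Finset.sum_congr rfl fun m _ => ?_
  rw [eval_monomial, Finsupp.prod_fintype _ _ (by simp), mul_assoc, ← Finset.prod_mul_distrib,
    Fin.prod_univ_succ]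
  simp only [Fin.cons_zero, Fin.cons_succ, one_pow, one_mul]
  congr 1
  refine Finset.prod_congr rfl fun i _ => ?_
  rw [tailMod_apply, ← hz i, ← pow_mul, ← pow_add, Nat.div_add_mod]

/-- Modulo the ideal, each block `Xᵢ^(k+1)` may be traded for `cᵢ X₀^(k+1)`. This preserves degree,
so homogenizing the reduced polynomial to degree `e` restores exactly the right power of `X₀`. -/
theorem sub_homogenizeTo_mem_powerIdeal {n k e : ℕ} (c : Fin n → ℂ) {g : Poly n}
    (hg : g.IsHomogeneous e) :
    g - homogenizeTo n e (reducedDehomogenization k c g) ∈ powerIdeal k c := by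
  rw [← Ideal.Quotient.eq, reducedDehomogenization, map_sum]
  conv_lhs => rw [g.as_sum]
  simp only [map_sum]
  refine Finset.sum_congr rfl fun m hm => ?_
  rw [homogenizeTo_monomial, monomial_eq, Finsupp.prod_fintype _ _ (by simp), Fin.prod_univ_succ]
  have hsum : m 0 + ∑ i : Fin n, m i.succ = e := by
    rw [← Fin.sum_univ_succ (fun i => m i), ← Finsupp.degree_eq_sum]
    by_contra hne
    exact mem_support_iff.1 hm (hg.coeff_eq_zero hne)
  have hexp : e - ∑ i, tailMod k m i = m 0 + ∑ i : Fin n, (k + 1) * (m i.succ / (k + 1)) := by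
    have h1 : ∑ i : Fin n, m i.succ =
        ∑ i : Fin n, (k + 1) * (m i.succ / (k + 1)) + ∑ i, tailMod k m i := by
      rw [← Finset.sum_add_distrib]
      exact Finset.sum_congr rfl fun i _ => (Nat.div_add_mod _ _).symm
    omega
  have hrel : ∀ i : Fin n, Ideal.Quotient.mk (powerIdeal k c) (X i.succ) ^ (k + 1) =
      Ideal.Quotient.mk (powerIdeal k c) (C (c i)) *
        Ideal.Quotient.mk (powerIdeal k c) (X 0) ^ (k + 1) := by
    intro i
    rw [← map_pow, ← map_pow, ← map_mul, Ideal.Quotient.eq]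
    exact Ideal.subset_span ⟨i, rfl⟩
  rw [hexp, pow_add, ← Finset.prod_pow_eq_pow_sum]
  simp only [map_mul, map_prod, map_pow]
  have hfac : ∀ i : Fin n, Ideal.Quotient.mk (powerIdeal k c) (X i.succ) ^ m i.succ =
      Ideal.Quotient.mk (powerIdeal k c) (C (c i)) ^ (m i.succ / (k + 1)) *
        (Ideal.Quotient.mk (powerIdeal k c) (X 0) ^ ((k + 1) * (m i.succ / (k + 1))) *
          Ideal.Quotient.mk (powerIdeal k c) (X i.succ) ^ tailMod k m i) := by
    intro i
    conv_lhs => rw [← Nat.div_add_mod (m i.succ) (k + 1), pow_add, pow_mul, hrel, mul_pow,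
      ← pow_mul]
    rw [mul_assoc, tailMod_apply]
  simp only [hfac, Finset.prod_mul_distrib]
  ring

theorem eval_smul_of_isHomogeneous {σ : Type*} [Fintype σ] {e : ℕ} {g : MvPolynomial σ ℂ}
    (hg : g.IsHomogeneous e) (r : ℂ) (a : σ → ℂ) : eval (r • a) g = r ^ e * eval a g := by
  rw [eval_eq', eval_eq', Finset.mul_sum]
  refine Finset.sum_congr rfl fun m hm => ?_
  have hdeg : ∑ i, m i = e := by
    rw [← Finsupp.degree_eq_sum]
    by_contra hne
    exact mem_support_iff.1 hm (hg.coeff_eq_zero hne)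
  simp only [Pi.smul_apply, smul_eq_mul, mul_pow, Finset.prod_mul_distrib]
  rw [Finset.prod_pow_eq_pow_sum, hdeg]
  ring

theorem mem_vanishingIdeal_generators_iff {n e : ℕ} {B : Set (Fin n → ℂ)} {g : Poly n}
    (hg : g.IsHomogeneous e) :
    (∀ (l : LinForm n) (hl : l ≠ 0), Projectivization.mk ℂ l hl ∈ affinePoint '' B →
      eval (coords l) g = 0) ↔ ∀ z ∈ B, eval (Fin.cons 1 z) g = 0 := by
  constructor
  · intro h z hz
    simpa only [coords_ofCoords] using h _ (ofCoords_cons_ne_zero z) ⟨z, hz, rfl⟩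
  · rintro h l hl ⟨z, hz, hlz⟩
    have h1 := ((mk_eq_affinePoint_iff hl z).1 hlz.symm).2
    have h2 : coords l = coords l 0 • (Fin.cons 1 z : Fin (n + 1) → ℂ) := by
      funext i
      refine Fin.cases ?_ (fun i => ?_) i
      · simp
      · simp [h1]
    rw [h2, eval_smul_of_isHomogeneous hg, h z hz, mul_zero]

/-- A form vanishing on the points reduces to a box polynomial vanishing at all nodes, hence to
zero, so the form lies in the power ideal. -/
theorem vanishingIdeal_powerPoints {n k : ℕ} (hk : 0 < k) {c : Fin n → ℂ}
    (hQ : affinePoint '' powerPoints k c ∈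
      VSPo (∑ _i : Fin (n + 1), k) (∏ _i : Fin n, (k + 1)) (monomialForm fun _ => k)) :
    vanishingIdeal (affinePoint '' powerPoints k c) = powerIdeal k c := by
  obtain ⟨a, ha, h0, -, hB⟩ := exists_hasMoments_of_mem_VSPo (d := fun _ => k) hk hQ
  have hB' := affinePoint_injective.image_injective hB
  apply le_antisymm
  · refine Ideal.span_le.2 ?_
    rintro g ⟨⟨e, hg⟩, hv⟩
    rw [mem_vanishingIdeal_generators_iff hg] at hv
    have hzero : reducedDehomogenization k c g = 0 := by
      refine ha.eq_zero_of_eval (inv_ne_zero (multinomialCoeff_ne_zero _)) hk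
        (reducedDehomogenization_mem k c g) fun j _ => ?_
      have hj : (fun i : Fin n => a j i.succ / a j 0) ∈ powerPoints k c := hB' ▸ ⟨j, rfl⟩
      rw [eval_reducedDehomogenization hj, hv _ hj]
    have := sub_homogenizeTo_mem_powerIdeal (k := k) c hg
    rwa [hzero, map_zero, sub_zero] at this
  · refine Ideal.span_le.2 ?_
    rintro _ ⟨i, rfl⟩
    have hg : (X i.succ ^ (k + 1) - C (c i) * X 0 ^ (k + 1) : Poly n).IsHomogeneous (k + 1) := by
      refine (isHomogeneous_X_pow _ _).sub ?_
      simpa using (isHomogeneous_C _ (c i)).mul (isHomogeneous_X_pow (0 : Fin (n + 1)) (k + 1))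
    refine Ideal.subset_span ⟨⟨k + 1, hg⟩, (mem_vanishingIdeal_generators_iff hg).2 ?_⟩
    intro z hz
    simp [hz i]

end Waring

end

theorem theorem1p4 (n : ℕ) (d : Fin (n + 1) → ℕ) (hpos : 0 < d 0) (hmono : Monotone d) :
    (Waring.VSPmono d : Set (Set (Waring.PLin n))).Nonempty ∧
    (MulAction.IsPretransitive (Waring.torus d) (Waring.VSPmono d) ↔ ∀ i, d i = d 0) ∧
    ∀ k : ℕ, (∀ i, d i = k) → ∀ Q ∈ Waring.VSPmono d,
      ∃ c : Fin n → ℂ, (∀ i, c i ≠ 0) ∧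
        Waring.vanishingIdeal Q = Waring.powerIdeal k c ∧
        ∃ t ∈ Waring.torus d,
          Waring.vanishingIdeal (t • Q) = Waring.powerIdeal k (fun _ => 1) := by
  refine ⟨Waring.VSPmono_nonempty hpos hmono,
    ⟨Waring.eq_of_isPretransitive hpos hmono, fun h => ?_⟩, fun k hdk Q hQ => ?_⟩
  · rw [show d = fun _ => d 0 from funext h]
    exact Waring.isPretransitive_of_eq hpos
  · obtain rfl : d = fun _ => k := funext hdk
    have hQ' := (Waring.mem_VSPmono_iff hpos hmono).1 hQ
    obtain ⟨c, hc, rfl⟩ := Waring.exists_eq_powerPoints hpos hQ'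
    obtain ⟨t, ht, h⟩ :=
      Waring.exists_torus_smul_powerPoints_eq k hc (fun _ => one_ne_zero)
    refine ⟨c, hc, Waring.vanishingIdeal_powerPoints hpos hQ', t, ht, ?_⟩
    -- The translate is again a minimal decomposition, so the ideal computation applies to it with
    -- all constants `1`.
    have htQ := Waring.smul_mem_VSPo _ _ (Waring.smul_monomialForm _ ht) hQ'
    rw [h] at htQ ⊢
    exact Waring.vanishingIdeal_powerPoints hpos htQ
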